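/- Let $N\ge 2$, $0<s<1<p<\infty$ with $sp<N$, let $0<\gamma<1$, $a>0$, $b\ge 0$, $\lambda,\mu>0$, and let $\Omega\subset\mathbb{R}^N$ be a bounded domain (no regularity of the boundary is assumed). Let $g,h:\Omega\to[0,\infty)$ be measurable and bounded, and let $K(x)=|x|^{-N-sp}$. Put $Q=\mathbb{R}^{2N}\setminus\big((\mathbb{R}^N\setminus\Omega)\times(\mathbb{R}^N\setminus\Omega)\big)$ and let $X_0$ be the space of Lebesgue measurable $u:\mathbb{R}^N\to\mathbb{R}$ with $u|_\Omega\in L^p(\Omega)$, $u=0$ a.e. in $\mathbb{R}^N\setminus\Omega$ and $$\|u\|:=\Big(\int_Q|u(x)-u(y)|^pK(x-y)\,dx\,dy\Big)^{1/p}<\infty .$$ Let $f:\Omega\times\mathbb{R}\to\mathbb{R}$ be a Carathéodory function for which there are $C>0$ and $q\in(p,p_s^*)$, $p_s^*=\frac{Np}{N-sp}$, with $|f(x,t)|\le C(1+|t|^{q-1})$ for a.e. $x\in\Omega$ and all $t\in\mathbb{R}$. Call $u\in X_0$ a weak solution of $$\Big(a+b\int_{\mathbb{R}^{2N}}|u(x)-u(y)|^pK(x-y)\,dx\,dy\Big)\mathfrak{L}_p^su-\lambda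 g(x)|u|^{p-2}u=\mu\frac{h(x)u}{|u|^{\gamma+1}}+f(x,u)\ \text{in }\Omega,\qquad u=0\ \text{in }\mathbb{R}^N\setminus\Omega,$$ where $\mathfrak{L}_p^su(x)=2\lim_{\epsilon\to0^+}\int_{\mathbb{R}^N\setminus B_\epsilon(x)}|u(x)-u(y)|^{p-2}(u(x)-u(y))K(x-y)\,dy$, if for every $\varphi\in X_0$ one has $h|u|^{-\gamma}\varphi\in L^1(\Omega)$ (with $|u|^{-\gamma}=+\infty$ where $u=0$, and $0\cdot\infty=0$) and $$(a+b\|u\|^p)\int_Q|u(x)-u(y)|^{p-2}(u(x)-u(y))(\varphi(x)-\varphi(y))K(x-y)\,dx\,dy-\lambda\int_\Omega g|u|^{p-2}u\varphi\,dx-\mu\int_\Omega h|u|^{-\gamma-1}u\varphi\,dx-\int_\Omega f(x,u)\varphi\,dx=0 .$$ Then every weak solution $u\in X_0$ of this problem belongs to $L^\infty(\Omega)$. -/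

import Mathlib

open MeasureTheory Set

noncomputable section

namespace KirchhoffSingular

/-- The kernel `K(x) = |x|^{-N-sp}` on `ℝ^N`. (Its value at the origin is irrelevant: it only enters
through `K (x - y)`, and the diagonal of `ℝ^N × ℝ^N` is a null set.) -/
def fracKernel (N : ℕ) (s p : ℝ) (x : EuclideanSpace ℝ (Fin N)) : ℝ :=
  ‖x‖ ^ (-(N : ℝ) - s * p)

/-- The fractional critical Sobolev exponent `p_s^* = Np / (N - sp)` (used for `sp < N`). -/
def critExp (N : ℕ) (s p : ℝ) : ℝ := N * p / (N - s * p)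

/-- `Q = ℝ^{2N} ∖ (C(Ω) × C(Ω))`, where `C(Ω) = ℝ^N ∖ Ω`. -/
def Q {N : ℕ} (Ω : Set (EuclideanSpace ℝ (Fin N))) :
    Set (EuclideanSpace ℝ (Fin N) × EuclideanSpace ℝ (Fin N)) :=
  (Ωᶜ ×ˢ Ωᶜ)ᶜ

/-- The integrand `|u(x) - u(y)|^p K(x - y)`. -/
def energyDensity {N : ℕ} (K : EuclideanSpace ℝ (Fin N) → ℝ) (p : ℝ)
    (u : EuclideanSpace ℝ (Fin N) → ℝ)
    (z : EuclideanSpace ℝ (Fin N) × EuclideanSpace ℝ (Fin N)) : ℝ :=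
  |u z.1 - u z.2| ^ p * K (z.1 - z.2)

/-- `u ∈ X`: `u : ℝ^N → ℝ` is Lebesgue measurable, `u|_Ω ∈ L^p(Ω)` and
`∫_Q |u(x) - u(y)|^p K(x - y) dx dy < ∞`. -/
structure MemX {N : ℕ} (Ω : Set (EuclideanSpace ℝ (Fin N)))
    (K : EuclideanSpace ℝ (Fin N) → ℝ) (p : ℝ) (u : EuclideanSpace ℝ (Fin N) → ℝ) : Prop where
  aemeasurable : AEMeasurable u volume
  memLp : MemLp u (ENNReal.ofReal p) (volume.restrict Ω)
  integrableOn : IntegrableOn (energyDensity K p u) (Q Ω) volume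

/-- `u ∈ X₀`: `u ∈ X` and `u = 0` a.e. in `ℝ^N ∖ Ω`. -/
structure MemX0 {N : ℕ} (Ω : Set (EuclideanSpace ℝ (Fin N)))
    (K : EuclideanSpace ℝ (Fin N) → ℝ) (p : ℝ) (u : EuclideanSpace ℝ (Fin N) → ℝ) : Prop
    extends MemX Ω K p u where
  ae_eq_zero : ∀ᵐ x ∂(volume : Measure (EuclideanSpace ℝ (Fin N))), x ∉ Ω → u x = 0

/-- The norm `‖u‖ = (∫_Q |u(x) - u(y)|^p K(x - y) dx dy)^{1/p}` of `X₀`. -/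
def normX0 {N : ℕ} (Ω : Set (EuclideanSpace ℝ (Fin N)))
    (K : EuclideanSpace ℝ (Fin N) → ℝ) (p : ℝ) (u : EuclideanSpace ℝ (Fin N) → ℝ) : ℝ :=
  (∫ z in Q Ω, energyDensity K p u z) ^ (1 / p)

/-- `⟨u, φ⟩ = ∫_Q |u(x)-u(y)|^{p-2} (u(x)-u(y)) (φ(x)-φ(y)) K(x-y) dx dy`. -/
def pairing {N : ℕ} (Ω : Set (EuclideanSpace ℝ (Fin N)))
    (K : EuclideanSpace ℝ (Fin N) → ℝ) (p : ℝ) (u φ : EuclideanSpace ℝ (Fin N) → ℝ) : ℝ :=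
  ∫ z in Q Ω, |u z.1 - u z.2| ^ (p - 2) * (u z.1 - u z.2) * (φ z.1 - φ z.2) * K (z.1 - z.2)

/-- `f : Ω × ℝ → ℝ` is a Carathéodory function: measurable in `x` for every `t`, and continuous in
`t` for a.e. `x ∈ Ω`. -/
structure IsCaratheodory {N : ℕ} (Ω : Set (EuclideanSpace ℝ (Fin N)))
    (f : EuclideanSpace ℝ (Fin N) → ℝ → ℝ) : Prop where
  aemeasurable : ∀ t : ℝ, AEMeasurable (fun x => f x t) (volume.restrict Ω)
  continuous : ∀ᵐ x ∂(volume.restrict Ω), Continuous (f x)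

/-- The growth condition: there are `C > 0` and `q ∈ (p, p_s^*)` with
`|f(x,t)| ≤ C (1 + |t|^{q-1})` for a.e. `x ∈ Ω` and all `t`. -/
def GrowthF1 {N : ℕ} (Ω : Set (EuclideanSpace ℝ (Fin N))) (s p : ℝ)
    (f : EuclideanSpace ℝ (Fin N) → ℝ → ℝ) : Prop :=
  ∃ C : ℝ, 0 < C ∧ ∃ q : ℝ, p < q ∧ q < critExp N s p ∧
    ∀ᵐ x ∂(volume.restrict Ω), ∀ t : ℝ, |f x t| ≤ C * (1 + |t| ^ (q - 1))

/-- `u ∈ X₀` is a weak solution of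
`(a + b‖u‖^p) 𝔏_p^s u - λ g |u|^{p-2} u = μ h |u|^{-γ-1} u + f(x,u)` in `Ω`, `u = 0` off `Ω`.

In `singular_integrable`, which says `h |u|^{-γ} φ ∈ L¹(Ω)`, the singular function `|u|^{-γ}` is
computed in `[0, ∞]`, so it is `+∞` where `u = 0` (in `ℝ` it would be given the value `0` there). -/
structure IsWeakSolution {N : ℕ} (Ω : Set (EuclideanSpace ℝ (Fin N)))
    (K : EuclideanSpace ℝ (Fin N) → ℝ) (p γ a b lam mu : ℝ)
    (g h : EuclideanSpace ℝ (Fin N) → ℝ) (f : EuclideanSpace ℝ (Fin N) → ℝ → ℝ)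
    (u : EuclideanSpace ℝ (Fin N) → ℝ) : Prop where
  memX0 : MemX0 Ω K p u
  singular_integrable : ∀ φ : EuclideanSpace ℝ (Fin N) → ℝ, MemX0 Ω K p φ →
    ∫⁻ x in Ω, ENNReal.ofReal (h x) * ENNReal.ofReal |u x| ^ (-γ) * ENNReal.ofReal |φ x| < ⊤
  weak_eq : ∀ φ : EuclideanSpace ℝ (Fin N) → ℝ, MemX0 Ω K p φ →
    (a + b * normX0 Ω K p u ^ p) * pairing Ω K p u φ
      - lam * (∫ x in Ω, g x * |u x| ^ (p - 2) * u x * φ x)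
      - mu * (∫ x in Ω, h x * |u x| ^ (-γ - 1) * u x * φ x)
      - (∫ x in Ω, f x (u x) * φ x) = 0

end KirchhoffSingular

end

/-! The proof is De Giorgi's method. Test the equation with the part of `u` beyond a level k ≥ 1.
This test function vanishes where |u| ≤ k, so the singularity at u = 0 is never met, and on {|u| >
k} each lower-order term is at most a constant times |u|^q. The Kirchhoff factor is at least a, and
the pairing dominates the energy of the excess because the truncation is monotone and 1-Lipschitz.
Hence the energy of the excess is at most A ∫_{|u|>k} |u|^q
(`IsWeakSolution.exists_integral_energyDensity_excess_le`).

For q < r < p_s^*, a Sobolev inequality (`exists_lintegral_rpow_le`) turns this into ∫ |excess|^r ≤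
S (A ∫_{|u|>k} |u|^q)^(r/p), whose exponent r/p exceeds 1. Along increasing bounded levels this
superlinearity forces the integrals to 0 once the first one is small
(`exists_tendsto_zero_of_le_mul_rpow`, `exists_ae_abs_le_of_excess`).

The Sobolev inequality is obtained from superlevel sets: nearby pairs on either side of a gap
between levels t/2 and t carry energy, which bounds |{|v| > t}| by a power of |{|v| > t/2}|.
Iteration gives weak L^{p_s^*}, hence L^r since Ω has finite measure. Functions vanish a.e. off Ω,
so the regularity of the boundary plays no role. -/

noncomputable section

namespace KirchhoffSingular

/-! ### Weak-type fractional Sobolev inequality -/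

/-- A measurable function `v` with `v = 0` outside `Ω` has at least the Gagliardo energy that comes
from the pairs `x, y` at distance less than `ρ` with `|v x| > t` and `|v y| ≤ t / 2`. -/
lemma mul_volume_superlevel_le_lintegral_energyDensity {N : ℕ} {s p : ℝ} (hs : 0 ≤ s) (hp : 0 ≤ p)
    {Ω : Set (EuclideanSpace ℝ (Fin N))} {v : EuclideanSpace ℝ (Fin N) → ℝ} (hv : Measurable v)
    (hv0 : ∀ᵐ x, x ∉ Ω → v x = 0) {t ρ : ℝ} (ht : 0 < t) :
    ENNReal.ofReal ((t / 2) ^ p * ρ ^ (-(N : ℝ) - s * p)) *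
        (volume {x | t < |v x|} *
          (volume (Metric.ball (0 : EuclideanSpace ℝ (Fin N)) ρ) - volume {x | t / 2 < |v x|})) ≤
      ∫⁻ z in Q Ω, ENNReal.ofReal (energyDensity (fracKernel N s p) p v z) := by
  set F : Set (EuclideanSpace ℝ (Fin N)) := {x | t < |v x|}
  set E : Set (EuclideanSpace ℝ (Fin N)) := {x | t / 2 < |v x|}
  have hF : MeasurableSet F := measurableSet_lt measurable_const hv.abs
  have hE : MeasurableSet E := measurableSet_lt measurable_const hv.abs
  set S : Set (EuclideanSpace ℝ (Fin N) × EuclideanSpace ℝ (Fin N)) :=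
    {z | z.1 ∈ F ∧ dist z.2 z.1 < ρ ∧ z.2 ∉ E}
  have hS : MeasurableSet S := by
    refine (measurable_fst hF).inter (MeasurableSet.inter ?_ (measurable_snd hE.compl))
    exact measurableSet_lt (measurable_snd.dist measurable_fst) measurable_const
  -- Pairs outside Q have both points off Ω, whereas |v x| > t > 0 puts a.e. such x in Ω.
  have hSQ : S ≤ᵐ[volume] Q Ω := by
    have h1 : ∀ᵐ z : EuclideanSpace ℝ (Fin N) × EuclideanSpace ℝ (Fin N), z.1 ∉ Ω → v z.1 = 0 :=
      Measure.quasiMeasurePreserving_fst.ae hv0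
    filter_upwards [h1] with z hz hzS hzQ
    have := hz hzQ.1
    have h2 : t < |v z.1| := hzS.1
    rw [this, abs_zero] at h2
    linarith
  have hvol : volume F * (volume (Metric.ball (0 : EuclideanSpace ℝ (Fin N)) ρ) - volume E) ≤
      volume S := by
    rw [Measure.volume_eq_prod, Measure.prod_apply hS, mul_comm, ← setLIntegral_const]
    refine (setLIntegral_mono_ae' hF (ae_of_all _ fun x hx => ?_)).trans
      (setLIntegral_le_lintegral F _)
    have hsub : Metric.ball x ρ \ E ⊆ Prod.mk x ⁻¹' S := fun y hy => ⟨hx, hy.1, hy.2⟩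
    rw [← Measure.addHaar_ball_center volume x ρ]
    exact le_measure_sdiff.trans (measure_mono hsub)
  calc _ ≤ ENNReal.ofReal ((t / 2) ^ p * ρ ^ (-(N : ℝ) - s * p)) * volume S := by gcongr
    _ = ∫⁻ z in S, ENNReal.ofReal ((t / 2) ^ p * ρ ^ (-(N : ℝ) - s * p)) := by
        rw [setLIntegral_const]
    _ ≤ ∫⁻ z in S, ENNReal.ofReal (energyDensity (fracKernel N s p) p v z) := by
        refine setLIntegral_mono_ae' hS (ae_of_all _ fun z hz => ENNReal.ofReal_le_ofReal ?_)
        obtain ⟨h1, h2, h3⟩ := hz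
        replace h1 : t < |v z.1| := h1
        replace h3 : |v z.2| ≤ t / 2 := not_lt.1 h3
        have hne : 0 < ‖z.1 - z.2‖ := by
          rw [norm_pos_iff, sub_ne_zero]
          intro h
          rw [h] at h1
          linarith
        have hd : ‖z.1 - z.2‖ ≤ ρ := by
          rw [← dist_eq_norm, dist_comm]
          exact h2.le
        have hv : t / 2 ≤ |v z.1 - v z.2| := by
          linarith [abs_sub_abs_le_abs_sub (v z.1) (v z.2)]
        have hexp : -(N : ℝ) - s * p ≤ 0 := by
          have : (0 : ℝ) ≤ N := N.cast_nonneg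
          nlinarith [mul_nonneg hs hp]
        unfold energyDensity fracKernel
        exact mul_le_mul (Real.rpow_le_rpow (by positivity) hv hp)
          (Real.rpow_le_rpow_of_nonpos hne hd hexp)
          (Real.rpow_nonneg (hne.le.trans hd) _) (by positivity)
    _ ≤ _ := lintegral_mono_set' hSQ

lemma volume_superlevel_le {N : ℕ} {Ω : Set (EuclideanSpace ℝ (Fin N))}
    {v : EuclideanSpace ℝ (Fin N) → ℝ} (hv0 : ∀ᵐ x, x ∉ Ω → v x = 0)
    {t : ℝ} (ht : 0 ≤ t) : volume {x | t < |v x|} ≤ volume Ω := by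
  refine measure_mono_ae ?_
  filter_upwards [hv0] with x hx hxt
  by_contra h
  have h2 : t < |v x| := hxt
  rw [hx h, abs_zero] at h2
  linarith

/-- Balls of twice the volume B of {|v| > t/2} have at least half their volume outside this set.
With that radius the energy bound reads (t/2)^p ρ^(-N-sp) A B ≤ J, where A is the volume of {|v| >
t} and ρ^(-N-sp) is a constant times B^(-1-sp/N); solving for A leaves B^(sp/N). -/
lemma measureReal_superlevel_le {N : ℕ} (hN : 0 < N) {s p : ℝ} (hs : 0 < s) (hp : 0 < p)
    {Ω : Set (EuclideanSpace ℝ (Fin N))} (hΩ : volume Ω ≠ ⊤)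
    {v : EuclideanSpace ℝ (Fin N) → ℝ} (hv : Measurable v)
    (hv0 : ∀ᵐ x, x ∉ Ω → v x = 0) {J : ℝ} (hJ : 0 ≤ J)
    (hvJ : ∫⁻ z in Q Ω, ENNReal.ofReal (energyDensity (fracKernel N s p) p v z) ≤
      ENNReal.ofReal J) {t : ℝ} (ht : 0 < t) :
    volume.real {x | t < |v x|} ≤
      2 ^ p * (2 / volume.real (Metric.ball (0 : EuclideanSpace ℝ (Fin N)) 1)) ^ (1 + s * p / N) *
        J * t ^ (-p) * volume.real {x | t / 2 < |v x|} ^ (s * p / N) := by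
  set w := volume.real (Metric.ball (0 : EuclideanSpace ℝ (Fin N)) 1)
  have hN' : (0 : ℝ) < N := by exact_mod_cast hN
  have hw : 0 < w := by
    refine ENNReal.toReal_pos (Metric.measure_ball_pos _ _ one_pos).ne' measure_ball_lt_top.ne
  have hE := ((volume_superlevel_le hv0 (half_pos ht).le).trans_lt hΩ.lt_top).ne
  have hF := ((volume_superlevel_le hv0 ht.le).trans_lt hΩ.lt_top).ne
  have hFE : volume.real {x | t < |v x|} ≤ volume.real {x | t / 2 < |v x|} :=
    measureReal_mono (fun x (hx : t < |v x|) => show t / 2 < |v x| by linarith) hE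
  set B := volume.real {x | t / 2 < |v x|} with hB
  set A := volume.real {x | t < |v x|} with hA
  -- If B = 0 the radius chosen below would degenerate, but then A = 0 as well.
  rcases (measureReal_nonneg (μ := volume) (s := {x | t / 2 < |v x|})).eq_or_lt with h0 | hBpos
  · rw [← hB] at h0
    exact (hFE.trans h0.symm.le).trans (by positivity)
  rw [← hB] at hBpos
  set ρ : ℝ := (2 * B / w) ^ (1 / (N : ℝ)) with hρ
  have hρ0 : 0 < ρ := by positivity
  have hball : volume (Metric.ball (0 : EuclideanSpace ℝ (Fin N)) ρ) = ENNReal.ofReal (2 * B) := by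
    rw [Measure.addHaar_ball_of_pos _ _ hρ0, finrank_euclideanSpace_fin, hρ, ← Real.rpow_natCast,
      ← Real.rpow_mul (by positivity), one_div, inv_mul_cancel₀ hN'.ne', Real.rpow_one,
      ← ENNReal.ofReal_toReal (a := volume (Metric.ball 0 1)) measure_ball_lt_top.ne,
      ← ENNReal.ofReal_mul (by positivity)]
    congr 1
    change 2 * B / w * w = _
    field_simp
  have key := (mul_volume_superlevel_le_lintegral_energyDensity hs.le hp.le hv hv0 (ρ := ρ)
    ht).trans hvJ
  rw [hball, ← ENNReal.ofReal_toReal hE, ← ENNReal.ofReal_toReal hF,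
    ← ENNReal.ofReal_sub _ ENNReal.toReal_nonneg, ← ENNReal.ofReal_mul ENNReal.toReal_nonneg,
    ← ENNReal.ofReal_mul (by positivity), ENNReal.ofReal_le_ofReal_iff hJ] at key
  change (t / 2) ^ p * ρ ^ (-(N : ℝ) - s * p) * (A * (2 * B - B)) ≤ J at key
  have hρpow : ρ ^ (-(N : ℝ) - s * p) = (2 / w) ^ (-(1 + s * p / N)) * (B⁻¹ * B ^ (-(s * p / N))) := by
    rw [hρ, ← Real.rpow_mul (by positivity), ← Real.rpow_neg_one B, ← Real.rpow_add hBpos,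
      show 2 * B / w = 2 / w * B by ring, Real.mul_rpow (by positivity) hBpos.le]
    congr 2 <;> field_simp <;> ring
  rw [hρpow, Real.div_rpow ht.le two_pos.le, Real.rpow_neg (by positivity),
    Real.rpow_neg hBpos.le] at key
  rw [Real.rpow_neg ht.le]
  have h1 : 0 < (2 / w) ^ (1 + s * p / N) := by positivity
  have h2 : 0 < B ^ (s * p / N) := by positivity
  have h3 : 0 < t ^ p := by positivity
  have h4 : (0 : ℝ) < 2 ^ p := by positivity
  calc A = 2 ^ p * (2 / w) ^ (1 + s * p / N) * (t ^ p / 2 ^ p * (((2 / w) ^ (1 + s * p / N))⁻¹ *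
          (B⁻¹ * (B ^ (s * p / N))⁻¹)) * (A * (2 * B - B))) * (t ^ p)⁻¹ * B ^ (s * p / N) := by
        field_simp
        ring
    _ ≤ _ := by gcongr

/-- A nonnegative solution of `m t ≤ D * m (t / 2) ^ θ` with `θ < 1` that tends to `0` along
`t / 2 ^ j` is at most `D ^ (1 / (1 - θ))`. -/
lemma le_rpow_of_le_mul_rpow_half {m : ℝ → ℝ} {D θ : ℝ} (hm : ∀ t, 0 ≤ m t)
    (hD : 0 ≤ D) (hθ0 : 0 ≤ θ) (hθ : θ < 1) (h : ∀ t, 0 < t → m t ≤ D * m (t / 2) ^ θ)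
    (hlim : ∀ t, 0 < t → Filter.Tendsto (fun j : ℕ => m (t / 2 ^ j)) Filter.atTop (nhds 0))
    {t : ℝ} (ht : 0 < t) : m t ≤ D ^ (1 / (1 - θ)) := by
  -- Any M > D ^ (1 / (1 - θ)) satisfies D * M ^ θ ≤ M, so the bound m ≤ M passes from t / 2 to t;
  -- the limit supplies some t / 2 ^ j at which it holds.
  refine le_of_forall_gt_imp_ge_of_dense fun M hM => ?_
  have hM0 : 0 < M := (Real.rpow_nonneg hD _).trans_lt hM
  have hDM : D * M ^ θ ≤ M := by
    have h1 : D ≤ M ^ (1 - θ) := by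
      have := Real.rpow_le_rpow (Real.rpow_nonneg hD _) hM.le (sub_nonneg.2 hθ.le)
      rwa [← Real.rpow_mul hD, one_div, inv_mul_cancel₀ (sub_pos.2 hθ).ne', Real.rpow_one] at this
    calc D * M ^ θ ≤ M ^ (1 - θ) * M ^ θ := by gcongr
      _ = M := by rw [← Real.rpow_add hM0, sub_add_cancel, Real.rpow_one]
  have hstep : ∀ j : ℕ, ∀ t, 0 < t → m (t / 2 ^ j) ≤ M → m t ≤ M := by
    intro j
    induction j with
    | zero => intro t _ h; simpa using h
    | succ j ih =>
      intro t ht hj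
      refine ih t ht ((h _ (by positivity)).trans (le_trans ?_ hDM))
      gcongr
      · exact hm _
      · rwa [div_div, ← pow_succ]
  obtain ⟨j, hj⟩ := ((hlim t ht).eventually_le_const hM0).exists
  exact hstep j t ht hj

/-- With c the critical exponent and θ = sp/N, one has cθ = c - p. Multiplying the halving estimate
by t^c therefore gives a closed recursion for m(t) = t^c |{|v| > t}|, with sublinear power θ < 1,
and 1/(1-θ) = c/p is the right power of the energy. -/
lemma exists_measureReal_superlevel_le {N : ℕ} (hN : 0 < N) {s p : ℝ} (hs : 0 < s) (hp : 0 < p)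
    (hsp : s * p < N) {Ω : Set (EuclideanSpace ℝ (Fin N))} (hΩ : volume Ω ≠ ⊤) :
    ∃ C : ℝ, 0 ≤ C ∧ ∀ v : EuclideanSpace ℝ (Fin N) → ℝ, Measurable v →
      (∀ᵐ x, x ∉ Ω → v x = 0) → ∀ J : ℝ, 0 ≤ J →
      ∫⁻ z in Q Ω, ENNReal.ofReal (energyDensity (fracKernel N s p) p v z) ≤ ENNReal.ofReal J →
      ∀ t : ℝ, 0 < t → volume.real {x | t < |v x|} ≤
        C * J ^ (critExp N s p / p) * t ^ (-critExp N s p) := by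
  have hN' : (0 : ℝ) < N := by exact_mod_cast hN
  have hNs : 0 < N - s * p := sub_pos.2 hsp
  set c := critExp N s p with hc
  have hc0 : 0 < c := by unfold critExp at hc; rw [hc]; positivity
  set θ := s * p / N with hθ
  have hθ0 : 0 ≤ θ := by positivity
  have hθ1 : θ < 1 := (div_lt_one hN').2 hsp
  set C₀ : ℝ := 2 ^ p * (2 / volume.real (Metric.ball (0 : EuclideanSpace ℝ (Fin N)) 1)) ^ (1 + θ)
  have hC₀ : 0 ≤ C₀ := by positivity
  refine ⟨(C₀ * 2 ^ (c * θ)) ^ (1 / (1 - θ)), by positivity, fun v hv hv0 J hJ hvJ t ht => ?_⟩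
  have hcp : c / p = 1 / (1 - θ) := by
    rw [hc, hθ, critExp]
    field_simp
  have hcθ : c * θ = c - p := by
    have h : c * (N - s * p) = N * p := div_mul_cancel₀ _ hNs.ne'
    rw [hθ, ← mul_div_assoc, div_eq_iff hN'.ne']
    linarith
  have hA : ∀ t, 0 ≤ volume.real {x | t < |v x|} := fun t => measureReal_nonneg
  -- The absolute value makes m nonnegative at every real t, as the iteration lemma demands.
  set m : ℝ → ℝ := fun t => |t| ^ c * volume.real {x | t < |v x|} with hm
  have hmain : m t ≤ (C₀ * 2 ^ (c * θ) * J) ^ (1 / (1 - θ)) := by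
    refine le_rpow_of_le_mul_rpow_half (fun t => ?_) (by positivity) hθ0 hθ1 (fun t ht => ?_)
      (fun t ht => ?_) ht
    · exact mul_nonneg (by positivity) (hA t)
    · have h := measureReal_superlevel_le hN hs hp hΩ hv hv0 hJ hvJ ht
      simp only [hm]
      rw [abs_of_pos ht, abs_of_pos (half_pos ht), Real.mul_rpow (by positivity) (hA _),
        ← Real.rpow_mul (by positivity), Real.div_rpow ht.le two_pos.le, hcθ]
      calc t ^ c * volume.real {x | t < |v x|} ≤ t ^ c * (C₀ * J * t ^ (-p) *
            volume.real {x | t / 2 < |v x|} ^ θ) := by gcongr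
        _ = _ := by
            rw [sub_eq_add_neg, Real.rpow_add ht]
            field_simp
    -- Since m(t) ≤ t^c |Ω|, the finite measure of Ω starts the iteration; no integrability of v is
    -- needed beforehand.
    · have h1 : Filter.Tendsto (fun j : ℕ => (t / 2 ^ j) ^ c * volume.real Ω) Filter.atTop
          (nhds 0) := by
        have h2 : Filter.Tendsto (fun j : ℕ => t / 2 ^ j) Filter.atTop (nhds 0) := by
          have := (tendsto_pow_atTop_nhds_zero_of_lt_one (r := (1 / 2 : ℝ)) (by norm_num)
            (by norm_num)).const_mul t
          simpa [div_eq_mul_inv] using this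
        have h3 := (h2.rpow_const (Or.inr hc0.le)).mul_const (volume.real Ω)
        rwa [Real.zero_rpow hc0.ne', zero_mul] at h3
      refine squeeze_zero (fun j => mul_nonneg (by positivity) (hA _)) (fun j => ?_) h1
      simp only [hm]
      rw [abs_of_pos (by positivity)]
      refine mul_le_mul_of_nonneg_left ?_ (by positivity)
      exact ENNReal.toReal_mono hΩ (volume_superlevel_le hv0 (by positivity))
  rw [Real.mul_rpow (by positivity) hJ, ← hcp] at hmain
  rw [← hcp, Real.rpow_neg ht.le, ← div_eq_mul_inv, le_div_iff₀ (by positivity), mul_comm]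
  simpa only [hm, abs_of_pos ht] using hmain

/-! ### From weak to strong integrability -/

/-- On a finite measure space, weak `L^c` is contained in `L^r` for `r < c`. -/
lemma lintegral_rpow_abs_le_of_superlevel_le {X : Type*} [MeasurableSpace X] {μ : Measure X}
    [IsFiniteMeasure μ] {v : X → ℝ} (hv : AEMeasurable v μ) {C T c r : ℝ} (hC : 0 ≤ C)
    (hT : 0 < T) (hr : 0 < r) (hrc : r < c)
    (h : ∀ t : ℝ, 0 < t → μ {x | t < |v x|} ≤ ENNReal.ofReal (C * T ^ c * t ^ (-c))) :
    ∫⁻ x, ENNReal.ofReal (|v x| ^ r) ∂μ ≤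
      ENNReal.ofReal ((μ.real univ + r * C / (c - r)) * T ^ r) := by
  -- Layer-cake formula split at height T: the total mass bounds the superlevel sets below T, the
  -- weak-type estimate those above. Both parts scale like T^r.
  rw [lintegral_rpow_eq_lintegral_meas_lt_mul μ (ae_of_all _ fun x => abs_nonneg _)
    (continuous_abs.measurable.comp_aemeasurable hv) hr, ← Ioc_union_Ioi_eq_Ioi hT.le,
    lintegral_union measurableSet_Ioi (Ioc_disjoint_Ioi le_rfl)]
  have h1 : ∫⁻ t in Ioc 0 T, μ {x | t < |v x|} * ENNReal.ofReal (t ^ (r - 1)) ≤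
      ENNReal.ofReal (μ.real univ * (T ^ r / r)) := by
    have hi : IntegrableOn (fun t : ℝ => μ.real univ * t ^ (r - 1)) (Ioc 0 T) :=
      ((intervalIntegrable_iff_integrableOn_Ioc_of_le hT.le).1
        (intervalIntegral.intervalIntegrable_rpow' (by linarith))).const_mul _
    have hI : ∫ t in Ioc 0 T, μ.real univ * t ^ (r - 1) = μ.real univ * (T ^ r / r) := by
      rw [integral_const_mul, ← intervalIntegral.integral_of_le hT.le,
        integral_rpow (Or.inl (by linarith)), sub_add_cancel, Real.zero_rpow hr.ne', sub_zero]
    rw [← hI, ofReal_integral_eq_lintegral_ofReal hi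
      ((ae_restrict_iff' measurableSet_Ioc).2 (ae_of_all _ fun t ht =>
        mul_nonneg measureReal_nonneg (Real.rpow_nonneg ht.1.le _)))]
    refine setLIntegral_mono_ae' measurableSet_Ioc (ae_of_all _ fun t _ => ?_)
    rw [ENNReal.ofReal_mul measureReal_nonneg, ofReal_measureReal]
    gcongr
    exact subset_univ _
  have h2 : ∫⁻ t in Ioi T, μ {x | t < |v x|} * ENNReal.ofReal (t ^ (r - 1)) ≤
      ENNReal.ofReal (C * (T ^ r / (c - r))) := by
    have hi : IntegrableOn (fun t : ℝ => C * T ^ c * t ^ (r - 1 - c)) (Ioi T) :=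
      (integrableOn_Ioi_rpow_of_lt (by linarith) hT).const_mul _
    have hI : ∫ t in Ioi T, C * T ^ c * t ^ (r - 1 - c) = C * (T ^ r / (c - r)) := by
      rw [integral_const_mul, integral_Ioi_rpow_of_lt (by linarith) hT,
        show r - 1 - c + 1 = -(c - r) by ring, neg_div_neg_eq, mul_assoc, ← mul_div_assoc,
        ← Real.rpow_add hT]
      congr 4
      ring
    rw [← hI, ofReal_integral_eq_lintegral_ofReal hi
      ((ae_restrict_iff' measurableSet_Ioi).2 (ae_of_all _ fun t ht =>
        mul_nonneg (by positivity) (Real.rpow_nonneg (hT.trans ht).le _)))]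
    refine setLIntegral_mono_ae' measurableSet_Ioi (ae_of_all _ fun t ht => ?_)
    have ht0 : 0 < t := hT.trans ht
    rw [show r - 1 - c = -c + (r - 1) by ring, Real.rpow_add ht0, ← mul_assoc,
      ENNReal.ofReal_mul (by positivity)]
    gcongr
    exact h t ht0
  have hcr : 0 < c - r := sub_pos.2 hrc
  calc _ ≤ ENNReal.ofReal r * (ENNReal.ofReal (μ.real univ * (T ^ r / r)) +
        ENNReal.ofReal (C * (T ^ r / (c - r)))) := by gcongr
    _ = _ := by
        rw [← ENNReal.ofReal_add (by positivity) (by positivity), ← ENNReal.ofReal_mul hr.le]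
        congr 1
        field_simp

/-- The subcritical fractional Sobolev inequality for functions vanishing outside a set of finite
measure. -/
lemma exists_lintegral_rpow_le {N : ℕ} (hN : 0 < N) {s p r : ℝ} (hs : 0 < s) (hp : 0 < p)
    (hsp : s * p < N) (hr : 0 < r) (hrc : r < critExp N s p)
    {Ω : Set (EuclideanSpace ℝ (Fin N))} (hΩ : volume Ω ≠ ⊤) :
    ∃ S : ℝ, 0 ≤ S ∧ ∀ v : EuclideanSpace ℝ (Fin N) → ℝ, AEMeasurable v volume →
      (∀ᵐ x, x ∉ Ω → v x = 0) → ∀ J : ℝ, 0 ≤ J →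
      ∫⁻ z in Q Ω, ENNReal.ofReal (energyDensity (fracKernel N s p) p v z) ≤ ENNReal.ofReal J →
      ∫⁻ x in Ω, ENNReal.ofReal (|v x| ^ r) ≤ ENNReal.ofReal (S * J ^ (r / p)) := by
  obtain ⟨C, hC, h⟩ := exists_measureReal_superlevel_le hN hs hp hsp hΩ
  have : IsFiniteMeasure (volume.restrict Ω) := ⟨by simpa using hΩ.lt_top⟩
  have hcr : 0 < critExp N s p - r := sub_pos.2 hrc
  set S := (volume.restrict Ω).real univ + r * C / (critExp N s p - r)
  have hS : 0 ≤ S := by positivity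
  refine ⟨S, hS, fun v hv hv0 J hJ hvJ => ?_⟩
  have hpos : ∀ J' : ℝ, 0 < J' → J ≤ J' →
      ∫⁻ x in Ω, ENNReal.ofReal (|v x| ^ r) ≤ ENNReal.ofReal (S * J' ^ (r / p)) := by
    intro J' hJ' hJJ'
    obtain ⟨w, hw, hvw⟩ := hv
    have hw0 : ∀ᵐ x, x ∉ Ω → w x = 0 := by
      filter_upwards [hv0, hvw] with x h1 h2 h3
      rw [← h2, h1 h3]
    have hwJ : ∫⁻ z in Q Ω, ENNReal.ofReal (energyDensity (fracKernel N s p) p w z) ≤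
        ENNReal.ofReal J' := by
      refine le_trans (le_of_eq ?_) (hvJ.trans (ENNReal.ofReal_le_ofReal hJJ'))
      refine lintegral_congr_ae (ae_restrict_of_ae ?_)
      have h1 : ∀ᵐ z : EuclideanSpace ℝ (Fin N) × EuclideanSpace ℝ (Fin N), v z.1 = w z.1 :=
        Measure.quasiMeasurePreserving_fst.ae hvw
      have h2 : ∀ᵐ z : EuclideanSpace ℝ (Fin N) × EuclideanSpace ℝ (Fin N), v z.2 = w z.2 :=
        Measure.quasiMeasurePreserving_snd.ae hvw
      filter_upwards [h1, h2] with z hz1 hz2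
      simp only [energyDensity, hz1, hz2]
    have hT : 0 < J' ^ (1 / p) := by positivity
    have hcongr : ∫⁻ x in Ω, ENNReal.ofReal (|v x| ^ r) = ∫⁻ x in Ω, ENNReal.ofReal (|w x| ^ r) :=
      lintegral_congr_ae (ae_restrict_of_ae (by filter_upwards [hvw] with x hx; rw [hx]))
    rw [hcongr]
    convert lintegral_rpow_abs_le_of_superlevel_le (μ := volume.restrict Ω) hw.aemeasurable hC hT
      hr hrc (fun t ht => ?_) using 2
    · rw [← Real.rpow_mul hJ'.le, one_div_mul_eq_div]
    · refine (Measure.restrict_apply_le _ _).trans ?_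
      have hfin := ((volume_superlevel_le hw0 ht.le).trans_lt hΩ.lt_top).ne
      rw [← ofReal_measureReal hfin, ← Real.rpow_mul hJ'.le, one_div_mul_eq_div]
      exact ENNReal.ofReal_le_ofReal (h w hw hw0 J' hJ'.le hwJ t ht)
  -- The cut height J^(1/p) must be positive, so zero energy is reached as the limit J' → 0+.
  rcases hJ.eq_or_lt with rfl | hJ
  · have hlim : Filter.Tendsto (fun J' : ℝ => ENNReal.ofReal (S * J' ^ (r / p)))
        (nhdsWithin 0 (Ioi 0)) (nhds (ENNReal.ofReal (S * 0 ^ (r / p)))) :=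
      (ENNReal.continuous_ofReal.tendsto _).comp
        (((Real.continuousAt_rpow_const _ _ (Or.inr (by positivity))).tendsto.const_mul S).mono_left
          nhdsWithin_le_nhds)
    refine ge_of_tendsto hlim ?_
    filter_upwards [self_mem_nhdsWithin] with J' hJ'
    exact hpos J' hJ' (le_of_lt hJ')
  · exact hpos J hJ le_rfl

/-! ### Nonlinear recursion -/

/-- Fast geometric convergence: a sequence with `y (n + 1) ≤ S * (A * B ^ n * y n) ^ β`, `β > 1`,
tends to `0` if `y 0` is small. -/
lemma exists_tendsto_zero_of_le_mul_rpow {S A B β : ℝ} (hS : 0 ≤ S) (hA : 0 ≤ A) (hB : 1 < B)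
    (hβ : 1 < β) : ∃ δ : ℝ, 0 < δ ∧ ∀ y : ℕ → ℝ, (∀ n, 0 ≤ y n) → y 0 ≤ δ →
      (∀ n, y (n + 1) ≤ S * (A * B ^ n * y n) ^ β) →
      Filter.Tendsto y Filter.atTop (nhds 0) := by
  have hB0 : 0 < B := one_pos.trans hB
  have hβ1 : 0 < β - 1 := sub_pos.2 hβ
  -- This ratio solves (B κ)^β = κ, so the bound δ κ^n reproduces itself with the growing factor B^n
  -- absorbed.
  set κ : ℝ := B ^ (-(β / (β - 1))) with hκ
  have hκ0 : 0 < κ := by positivity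
  have hκ1 : κ < 1 := Real.rpow_lt_one_of_one_lt_of_neg hB (by
    have : 0 < β / (β - 1) := by positivity
    linarith)
  have hBκ : B ^ β * κ ^ β = κ := by
    rw [hκ, ← Real.rpow_mul hB0.le, ← Real.rpow_add hB0]
    congr 1
    field_simp
    ring
  have hSA : 0 < S * A ^ β + 1 := by positivity
  -- Chosen so that S A^β δ^(β-1) ≤ κ; the added 1 keeps the denominator positive when S A^β = 0.
  refine ⟨(κ / (S * A ^ β + 1)) ^ (1 / (β - 1)), by positivity, fun y hy hy0 hstep => ?_⟩
  set δ := (κ / (S * A ^ β + 1)) ^ (1 / (β - 1)) with hδ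
  have hδ0 : 0 < δ := by positivity
  have hδβ : S * A ^ β * δ ^ β ≤ δ * κ := by
    have h1 : δ ^ (β - 1) = κ / (S * A ^ β + 1) := by
      rw [hδ, ← Real.rpow_mul (by positivity), one_div, inv_mul_cancel₀ hβ1.ne', Real.rpow_one]
    have h2 : δ ^ β = δ * δ ^ (β - 1) := by
      rw [← Real.rpow_one_add' hδ0.le (by linarith)]
      congr 1
      ring
    rw [h2, h1]
    calc S * A ^ β * (δ * (κ / (S * A ^ β + 1))) ≤
          (S * A ^ β + 1) * (δ * (κ / (S * A ^ β + 1))) := by gcongr; linarith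
      _ = δ * κ := by field_simp
  have hbound : ∀ n, y n ≤ δ * κ ^ n := by
    intro n
    induction n with
    | zero => simpa using hy0
    | succ n ih =>
      calc y (n + 1) ≤ S * (A * B ^ n * y n) ^ β := hstep n
        _ ≤ S * (A * B ^ n * (δ * κ ^ n)) ^ β := by
            have := hy n
            gcongr
        _ = S * A ^ β * δ ^ β * (B ^ β * κ ^ β) ^ n := by
            rw [show A * B ^ n * (δ * κ ^ n) = A * δ * (B * κ) ^ n by rw [mul_pow]; ring,
              Real.mul_rpow (by positivity) (by positivity), Real.mul_rpow hA hδ0.le,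
              ← Real.mul_rpow hB0.le hκ0.le, Real.rpow_pow_comm (by positivity)]
            ring
        _ ≤ δ * κ * κ ^ n := by
            rw [hBκ]
            gcongr
        _ = δ * κ ^ (n + 1) := by ring
  refine squeeze_zero hy hbound ?_
  simpa using (tendsto_pow_atTop_nhds_zero_of_lt_one hκ0.le hκ1).const_mul δ

/-! ### Truncations as test functions and the Caccioppoli inequality -/

/-- The part of `t` exceeding the level `k` in absolute value, `sign t * (|t| - k)⁺`. -/
def excess (k t : ℝ) : ℝ := t - max (-k) (min t k)

lemma continuous_excess (k : ℝ) : Continuous (excess k) := by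
  unfold excess
  fun_prop

lemma monotone_excess (k : ℝ) : Monotone (excess k) := by
  intro x y h
  unfold excess
  rcases max_cases (-k) (min x k) with h1 | h1 <;> rcases max_cases (-k) (min y k) with h2 | h2 <;>
    rcases min_cases x k with h3 | h3 <;> rcases min_cases y k with h4 | h4 <;> linarith

lemma abs_excess_sub_excess_le (k x y : ℝ) : |excess k x - excess k y| ≤ |x - y| := by
  have hmono : ∀ x y : ℝ, x ≤ y → |excess k x - excess k y| ≤ |x - y| := by
    intro x y h
    rw [abs_of_nonpos (sub_nonpos.2 (monotone_excess k h)), abs_of_nonpos (sub_nonpos.2 h)]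
    have : max (-k) (min x k) ≤ max (-k) (min y k) := max_le_max le_rfl (min_le_min h le_rfl)
    unfold excess
    linarith
  rcases le_total x y with h | h
  · exact hmono x y h
  · rw [abs_sub_comm, abs_sub_comm x]
    exact hmono y x h

lemma abs_excess {k : ℝ} (hk : 0 ≤ k) (t : ℝ) : |excess k t| = max (|t| - k) 0 := by
  unfold excess
  rcases max_cases (-k) (min t k) with h1 | h1 <;> rcases min_cases t k with h3 | h3 <;>
    rcases max_cases (|t| - k) 0 with h5 | h5 <;> rcases abs_cases t with h7 | h7 <;>
    rcases abs_cases (t - max (-k) (min t k)) with h6 | h6 <;> linarith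

lemma excess_eq_zero {k : ℝ} {t : ℝ} (h : |t| ≤ k) : excess k t = 0 := by
  rw [← abs_eq_zero, abs_excess ((abs_nonneg t).trans h), max_eq_right (sub_nonpos.2 h)]

lemma abs_excess_le {k : ℝ} (hk : 0 ≤ k) (t : ℝ) : |excess k t| ≤ |t| := by
  rw [abs_excess hk]
  exact max_le (by linarith) (abs_nonneg t)

variable {N : ℕ} {Ω : Set (EuclideanSpace ℝ (Fin N))} {K : EuclideanSpace ℝ (Fin N) → ℝ} {p : ℝ}
  {u : EuclideanSpace ℝ (Fin N) → ℝ}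

lemma energyDensity_nonneg (hK : ∀ x, 0 ≤ K x)
    (z : EuclideanSpace ℝ (Fin N) × EuclideanSpace ℝ (Fin N)) : 0 ≤ energyDensity K p u z :=
  mul_nonneg (by positivity) (hK _)

lemma aemeasurable_comp_fst_sub_comp_snd (hu : AEMeasurable u volume) :
    AEMeasurable (fun z : EuclideanSpace ℝ (Fin N) × EuclideanSpace ℝ (Fin N) => u z.1 - u z.2)
      volume :=
  (hu.comp_quasiMeasurePreserving Measure.quasiMeasurePreserving_fst).sub
    (hu.comp_quasiMeasurePreserving Measure.quasiMeasurePreserving_snd)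

/-- Admissibility as a test function: the truncation is 1-Lipschitz and fixes 0, so it increases
neither |u| nor the energy density. -/
lemma MemX0.excess (hK : ∀ x, 0 ≤ K x) (hKm : Measurable K) (hp : 0 ≤ p) (hu : MemX0 Ω K p u)
    {k : ℝ} (hk : 0 ≤ k) : MemX0 Ω K p fun x => excess k (u x) where
  aemeasurable := (continuous_excess k).measurable.comp_aemeasurable hu.aemeasurable
  memLp := hu.memLp.mono ((continuous_excess k).comp_aestronglyMeasurable hu.memLp.1)
    (ae_of_all _ fun x => abs_excess_le hk _)
  integrableOn := by
    refine hu.integrableOn.mono' (AEMeasurable.aestronglyMeasurable (AEMeasurable.restrict ?_))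
      (ae_of_all _ fun z => ?_)
    · refine AEMeasurable.mul (AEMeasurable.pow_const ?_ p)
        (hKm.comp (measurable_fst.sub measurable_snd)).aemeasurable
      exact continuous_abs.measurable.comp_aemeasurable (aemeasurable_comp_fst_sub_comp_snd
        ((continuous_excess k).measurable.comp_aemeasurable hu.aemeasurable))
    · rw [Real.norm_of_nonneg (energyDensity_nonneg hK z)]
      exact mul_le_mul_of_nonneg_right (Real.rpow_le_rpow (abs_nonneg _)
        (abs_excess_sub_excess_le k _ _) hp) (hK _)
  ae_eq_zero := by
    filter_upwards [hu.ae_eq_zero] with x hx hxΩ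
    rw [hx hxΩ]
    exact excess_eq_zero (by simpa using hk)

lemma rpow_sub_two_mul_self_mul_excess {k : ℝ} (x y : ℝ) :
    |x - y| ^ (p - 2) * (x - y) * (excess k x - excess k y) =
      |x - y| ^ (p - 2) * |x - y| * |excess k x - excess k y| := by
  rw [mul_assoc, mul_assoc]
  congr 1
  rw [← abs_mul]
  refine (abs_of_nonneg ?_).symm
  rcases le_total x y with h | h
  · exact mul_nonneg_of_nonpos_of_nonpos (sub_nonpos.2 h) (sub_nonpos.2 (monotone_excess k h))
  · exact mul_nonneg (sub_nonneg.2 h) (sub_nonneg.2 (monotone_excess k h))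

lemma rpow_sub_two_mul_mul {d : ℝ} (hd : 0 < d) (p e : ℝ) :
    d ^ (p - 2) * d * e = d ^ (p - 1) * e := by
  rw [← Real.rpow_add_one hd.ne']
  congr 2
  ring

/-- Put d = |u(x) - u(y)| and let e be the corresponding difference of excesses. Monotonicity makes
the pairing integrand d^(p-1) e K, and 0 ≤ e ≤ d gives e^p ≤ d^(p-1) e ≤ d^p. The last inequality
yields integrability of the pairing. -/
lemma integral_energyDensity_excess_le_pairing (hK : ∀ x, 0 ≤ K x) (hKm : Measurable K)
    (hp : 1 < p) (hu : MemX0 Ω K p u) {k : ℝ} (hk : 0 ≤ k) :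
    ∫ z in Q Ω, energyDensity K p (fun x => excess k (u x)) z ≤
      pairing Ω K p u fun x => excess k (u x) := by
  have hpt : ∀ d e : ℝ, 0 ≤ e → e ≤ d → e ^ p ≤ d ^ (p - 2) * d * e ∧
      d ^ (p - 2) * d * e ≤ d ^ p := by
    intro d e he hed
    -- At d = 0 the powers cannot be merged, but e = 0 too and all three expressions vanish.
    rcases (he.trans hed).eq_or_lt with h0 | hd
    · have : e = 0 := le_antisymm (h0 ▸ hed) he
      simp [← h0, this, Real.zero_rpow (one_pos.trans hp).ne']
    have hpow : ∀ c : ℝ, 0 ≤ c → c ^ p = c ^ (p - 1) * c := fun c hc => by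
      rw [← Real.rpow_add_one' hc (by linarith), sub_add_cancel]
    rw [rpow_sub_two_mul_mul hd, hpow e he, hpow d hd.le]
    have hp1 : 0 ≤ p - 1 := by linarith
    constructor <;> gcongr
  refine integral_mono (hu.excess hK hKm (by linarith) hk).integrableOn
    (hu.integrableOn.mono' (AEMeasurable.aestronglyMeasurable (AEMeasurable.restrict ?_))
      (ae_of_all _ fun z => ?_)) fun z => ?_
  · have h1 := aemeasurable_comp_fst_sub_comp_snd hu.aemeasurable
    have h2 := aemeasurable_comp_fst_sub_comp_snd
        ((continuous_excess k).measurable.comp_aemeasurable hu.aemeasurable)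
    exact ((((continuous_abs.measurable.comp_aemeasurable h1).pow_const _).mul h1).mul h2).mul
      (hKm.comp (measurable_fst.sub measurable_snd)).aemeasurable
  · rw [rpow_sub_two_mul_self_mul_excess, Real.norm_of_nonneg (mul_nonneg (by positivity) (hK _))]
    exact mul_le_mul_of_nonneg_right
      (hpt _ _ (abs_nonneg _) (abs_excess_sub_excess_le _ _ _)).2 (hK _)
  · simp only [rpow_sub_two_mul_self_mul_excess]
    exact mul_le_mul_of_nonneg_right
      (hpt _ _ (abs_nonneg _) (abs_excess_sub_excess_le _ _ _)).1 (hK _)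

/-- Covers the term with g (e = p - 2) and the singular term (e = -γ - 1) at once: above level 1,
larger exponents give larger powers. -/
lemma rpow_mul_abs_mul_abs_excess_le {k e q t : ℝ} (hk : 1 ≤ k) (he : e + 2 ≤ q) (ht : k < |t|) :
    |t| ^ e * |t| * |excess k t| ≤ |t| ^ q := by
  have ht0 : 0 < |t| := by linarith
  calc |t| ^ e * |t| * |excess k t| ≤ |t| ^ e * |t| * |t| := by
        exact mul_le_mul_of_nonneg_left (abs_excess_le (by linarith) t) (by positivity)
    _ = |t| ^ (e + 2) := by rw [Real.rpow_add ht0, Real.rpow_two]; ring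
    _ ≤ |t| ^ q := Real.rpow_le_rpow_of_exponent_le (by linarith) he

/-- Testing the equation with the part of `u` exceeding the level `k` gives a Caccioppoli type
inequality. -/
lemma IsWeakSolution.exists_integral_energyDensity_excess_le (hK : ∀ x, 0 ≤ K x)
    (hKm : Measurable K) (hp : 1 < p) {γ a b lam mu C q : ℝ} (hγ : 0 ≤ γ) (ha : 0 < a)
    (hb : 0 ≤ b) (hlam : 0 ≤ lam) (hmu : 0 ≤ mu) (hΩ : MeasurableSet Ω)
    {g h : EuclideanSpace ℝ (Fin N) → ℝ} {f : EuclideanSpace ℝ (Fin N) → ℝ → ℝ}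
    (hg0 : ∀ x ∈ Ω, 0 ≤ g x) (hh0 : ∀ x ∈ Ω, 0 ≤ h x)
    (hgb : ∃ M : ℝ, ∀ x ∈ Ω, g x ≤ M) (hhb : ∃ M : ℝ, ∀ x ∈ Ω, h x ≤ M)
    (hC : 0 ≤ C) (hpq : p ≤ q)
    (hf : ∀ᵐ x ∂(volume.restrict Ω), ∀ t : ℝ, |f x t| ≤ C * (1 + |t| ^ (q - 1)))
    (hu : IsWeakSolution Ω K p γ a b lam mu g h f u)
    (huq : IntegrableOn (fun x => |u x| ^ q) Ω) :
    ∃ A : ℝ, 0 ≤ A ∧ ∀ k : ℝ, 1 ≤ k →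
      ∫ z in Q Ω, energyDensity K p (fun x => excess k (u x)) z ≤
        A * ∫ x in Ω, {x | k < |u x|}.indicator (fun x => |u x| ^ q) x := by
  obtain ⟨Mg, hMg⟩ := hgb
  obtain ⟨Mh, hMh⟩ := hhb
  refine ⟨(lam * |Mg| + mu * |Mh| + 2 * C) / a, by positivity, fun k hk => ?_⟩
  have hk0 : 0 ≤ k := by linarith
  have hX := hu.memX0.excess hK hKm (by linarith) hk0
  set φ : EuclideanSpace ℝ (Fin N) → ℝ := fun x => excess k (u x) with hφ
  set i : EuclideanSpace ℝ (Fin N) → ℝ := {x | k < |u x|}.indicator (fun x => |u x| ^ q) with hi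
  have hiI : IntegrableOn i Ω := huq.indicator₀ <|
    nullMeasurableSet_lt aemeasurable_const
      (continuous_abs.measurable.comp_aemeasurable hu.memX0.aemeasurable).restrict
  have hweak := hu.weak_eq φ hX
  have hlow := integral_energyDensity_excess_le_pairing hK hKm hp hu.memX0 hk0
  have hbound : ∀ (F : EuclideanSpace ℝ (Fin N) → ℝ) (M : ℝ),
      (∀ᵐ x ∂(volume.restrict Ω), k < |u x| → |F x * φ x| ≤ M * |u x| ^ q) →
      |∫ x in Ω, F x * φ x| ≤ M * ∫ x in Ω, i x := by
    intro F M hF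
    rw [← integral_const_mul, ← Real.norm_eq_abs]
    refine norm_integral_le_of_norm_le (hiI.const_mul M) ?_
    filter_upwards [hF] with x hx
    by_cases hux : k < |u x|
    · simpa [hi, hux] using hx hux
    · simp [hi, hux, hφ, excess_eq_zero (not_lt.1 hux)]
  have hcoef : ∀ (F : EuclideanSpace ℝ (Fin N) → ℝ) (M e : ℝ), (∀ x ∈ Ω, 0 ≤ F x) →
      (∀ x ∈ Ω, F x ≤ M) → e + 2 ≤ q →
      |∫ x in Ω, F x * |u x| ^ e * u x * φ x| ≤ |M| * ∫ x in Ω, i x := by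
    intro F M e hF0 hFM he
    refine hbound (fun x => F x * |u x| ^ e * u x) |M| ?_
    filter_upwards [ae_restrict_mem hΩ] with x hx hux
    rw [abs_mul, abs_mul, abs_mul, abs_of_nonneg (hF0 x hx),
      abs_of_nonneg (Real.rpow_nonneg (abs_nonneg (u x)) e), mul_assoc, mul_assoc,
      ← mul_assoc (|u x| ^ e)]
    have := hF0 x hx
    exact mul_le_mul ((hFM x hx).trans (le_abs_self M))
      (rpow_mul_abs_mul_abs_excess_le hk he hux) (by positivity) (abs_nonneg M)
  have h1 := hcoef g Mg (p - 2) hg0 hMg (by linarith)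
  have h2 := hcoef h Mh (-γ - 1) hh0 hMh (by linarith)
  have h3 : |∫ x in Ω, f x (u x) * φ x| ≤ 2 * C * ∫ x in Ω, i x := by
    refine hbound (fun x => f x (u x)) (2 * C) ?_
    filter_upwards [hf] with x hx hux
    have hu1 : 1 ≤ |u x| := by linarith
    have hu2 : (1 : ℝ) ≤ |u x| ^ (q - 1) := Real.one_le_rpow hu1 (by linarith)
    calc |f x (u x) * φ x| = |f x (u x)| * |φ x| := abs_mul _ _
      _ ≤ C * (|u x| ^ (q - 1) + |u x| ^ (q - 1)) * |u x| :=
        mul_le_mul ((hx _).trans (by gcongr)) (abs_excess_le hk0 _) (abs_nonneg _) (by positivity)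
      _ = 2 * C * (|u x| ^ (q - 1) * |u x|) := by ring
      _ = 2 * C * |u x| ^ q := by
        rw [← Real.rpow_add_one' (abs_nonneg _) (by linarith), sub_add_cancel]
  have hnorm : 0 ≤ normX0 Ω K p u ^ p := by
    refine Real.rpow_nonneg (Real.rpow_nonneg (integral_nonneg fun z => ?_) _) _
    exact energyDensity_nonneg hK z
  have henergy : 0 ≤ ∫ z in Q Ω, energyDensity K p φ z :=
    integral_nonneg fun z => energyDensity_nonneg hK z
  -- The nonlocal coefficient is only bounded below by a.
  rw [div_mul_eq_mul_div, le_div_iff₀ ha]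
  have h4 : a * ∫ z in Q Ω, energyDensity K p φ z ≤
      (a + b * normX0 Ω K p u ^ p) * pairing Ω K p u φ :=
    mul_le_mul (le_add_of_nonneg_right (mul_nonneg hb hnorm)) hlow henergy (by positivity)
  have h5 := mul_le_mul_of_nonneg_left ((le_abs_self _).trans h1) hlam
  have h6 := mul_le_mul_of_nonneg_left ((le_abs_self _).trans h2) hmu
  have h7 := (le_abs_self _).trans h3
  linarith

/-! ### De Giorgi iteration -/

/-- De Giorgi's iteration on the levels `M * (2 - 2⁻ⁿ)`. -/
lemma exists_ae_abs_le_of_excess {X : Type*} [MeasurableSpace X] {μ : Measure X} {u : X → ℝ}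
    (hu : AEMeasurable u μ) {q r β A S : ℝ} (hqr : q ≤ r) (hr : 0 < r) (hβ : 1 < β)
    (hA : 0 ≤ A) (hS : 0 ≤ S) (hur : Integrable (fun x => |u x| ^ r) μ)
    (h : ∀ k : ℝ, 1 ≤ k → ∫ x, |excess k (u x)| ^ r ∂μ ≤
      S * (A * ∫ x, {x | k < |u x|}.indicator (fun x => |u x| ^ q) x ∂μ) ^ β) :
    ∃ M : ℝ, ∀ᵐ x ∂μ, |u x| ≤ M := by
  have hmeas : ∀ k : ℝ, AEStronglyMeasurable (fun x => |excess k (u x)| ^ r) μ := fun k =>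
    ((continuous_abs.measurable.comp (continuous_excess k).measurable).comp_aemeasurable
      hu).pow_const r |>.aestronglyMeasurable
  have hle : ∀ k : ℝ, 0 ≤ k → ∀ x, ‖|excess k (u x)| ^ r‖ ≤ |u x| ^ r := fun k hk x => by
    rw [Real.norm_of_nonneg (by positivity)]
    exact Real.rpow_le_rpow (abs_nonneg _) (abs_excess_le hk _) hr.le
  have hint : ∀ k : ℝ, 0 ≤ k → Integrable (fun x => |excess k (u x)| ^ r) μ := fun k hk =>
    hur.mono' (hmeas k) (ae_of_all _ (hle k hk))
  -- The constants come from (2^(n+2))^r = 4^r (2^r)^n, the cost of passing from level n to level n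
  -- + 1.
  obtain ⟨δ, hδ, hconv⟩ := exists_tendsto_zero_of_le_mul_rpow (S := S) (A := A * 4 ^ r)
    (B := 2 ^ r) hS (by positivity) (Real.one_lt_rpow one_lt_two hr) hβ
  have hlim : Filter.Tendsto (fun m : ℕ => ∫ x, |excess (m : ℝ) (u x)| ^ r ∂μ) Filter.atTop
      (nhds 0) := by
    have := tendsto_integral_of_dominated_convergence (μ := μ) (f := fun _ => (0 : ℝ))
      (F := fun (m : ℕ) x => |excess (m : ℝ) (u x)| ^ r) (fun x => |u x| ^ r)
      (fun m => hmeas m) hur (fun m => ae_of_all _ (hle m m.cast_nonneg))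
      (ae_of_all _ fun x => tendsto_const_nhds.congr' ?_)
    · simpa using this
    · filter_upwards [Filter.eventually_ge_atTop ⌈|u x|⌉₊] with m hm
      rw [excess_eq_zero (Nat.ceil_le.1 hm), abs_zero, Real.zero_rpow hr.ne']
  -- The smallness of the initial term is obtained by starting from a high level, via dominated
  -- convergence.
  obtain ⟨m, hmδ, hm1⟩ := ((hlim.eventually_le_const hδ).and
    (Filter.eventually_ge_atTop 1)).exists
  set M : ℝ := (m : ℝ)
  have hM : 1 ≤ M := Nat.one_le_cast.2 hm1
  set k : ℕ → ℝ := fun n => M * (2 - (1 / 2) ^ n) with hk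
  have hpow : ∀ n : ℕ, (1 / 2 : ℝ) ^ n ≤ 1 := fun n => pow_le_one₀ (by norm_num) (by norm_num)
  have hpow0 : ∀ n : ℕ, 0 < (1 / 2 : ℝ) ^ n := fun n => by positivity
  have hkM : ∀ n, M ≤ k n := fun n => le_mul_of_one_le_right (by positivity) (by linarith [hpow n])
  have hkM2 : ∀ n, k n ≤ M * 2 := fun n =>
    mul_le_mul_of_nonneg_left (by linarith [hpow0 n]) (by positivity)
  have hzero := hconv (fun n => ∫ x, |excess (k n) (u x)| ^ r ∂μ)
    (fun n => integral_nonneg fun x => by positivity) ?_ fun n => ?_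
  · refine ⟨M * 2, ?_⟩
    have hle0 : ∫ x, |excess (M * 2) (u x)| ^ r ∂μ ≤ 0 := by
      refine ge_of_tendsto' hzero fun n => integral_mono (hint _ (by linarith))
        (hint _ (by linarith [hkM n])) fun x => Real.rpow_le_rpow (abs_nonneg _) ?_ hr.le
      rw [abs_excess (by linarith), abs_excess (by linarith [hkM n])]
      exact max_le_max (by linarith [hkM2 n]) le_rfl
    have hae := (integral_eq_zero_iff_of_nonneg (fun x => by positivity)
      (hint (M * 2) (by linarith))).1 (le_antisymm hle0 (integral_nonneg fun x => by positivity))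
    filter_upwards [hae] with x hx
    have hx0 : |excess (M * 2) (u x)| = 0 :=
      (Real.rpow_eq_zero (abs_nonneg _) hr.ne').1 hx
    rw [abs_excess (by linarith)] at hx0
    linarith [le_max_left (|u x| - M * 2) 0]
  · simpa [hk, show (2 : ℝ) - 1 = 1 by norm_num] using hmδ
  · refine (h (k (n + 1)) (hM.trans (hkM _))).trans ?_
    have hD : ((2 : ℝ) ^ (n + 2)) ^ r = 4 ^ r * (2 ^ r) ^ n := by
      rw [pow_add, mul_comm, Real.mul_rpow (by positivity) (by positivity),
        Real.rpow_pow_comm two_pos.le]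
      norm_num
    -- The gap is M 2^(-n-1) and the levels stay below 2M. Consequently |u| ≤ 2^(n+2) (|u| - k_n)
    -- wherever |u| > k_(n+1), which bounds |u|^q ≤ |u|^r by the previous excess.
    have hgap : k (n + 1) ≤ 2 ^ (n + 2) * (k (n + 1) - k n) := by
      refine (hkM2 _).trans (le_of_eq ?_)
      simp only [hk]
      rw [one_div, inv_pow, inv_pow, pow_succ, pow_add]
      field_simp
      ring
    have hind : ∫ x, {x | k (n + 1) < |u x|}.indicator (fun x => |u x| ^ q) x ∂μ ≤
        4 ^ r * (2 ^ r) ^ n * ∫ x, |excess (k n) (u x)| ^ r ∂μ := by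
      rw [← integral_const_mul, ← hD]
      refine integral_mono_of_nonneg (ae_of_all _ fun x => indicator_nonneg
        (fun x _ => by positivity) x) ((hint _ (by linarith [hkM n])).const_mul _)
        (ae_of_all _ fun x => ?_)
      by_cases hx : k (n + 1) < |u x|
      · simp only [indicator, mem_ofPred_eq, hx, if_true]
        have hu1 : 1 ≤ |u x| := by linarith [hkM (n + 1)]
        have hD1 : (1 : ℝ) ≤ 2 ^ (n + 2) := one_le_pow₀ one_le_two
        have hux : |u x| ≤ 2 ^ (n + 2) * |excess (k n) (u x)| := by
          rw [abs_excess (by linarith [hkM n])]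
          refine le_trans ?_ (mul_le_mul_of_nonneg_left (le_max_left _ _) (by positivity))
          nlinarith
        rw [← Real.mul_rpow (by positivity) (abs_nonneg _)]
        exact (Real.rpow_le_rpow_of_exponent_le hu1 hqr).trans
          (Real.rpow_le_rpow (abs_nonneg _) hux hr.le)
      · simp only [indicator, mem_ofPred_eq, hx, if_false]
        positivity
    have hind0 : 0 ≤ ∫ x, {x | k (n + 1) < |u x|}.indicator (fun x => |u x| ^ q) x ∂μ :=
      integral_nonneg fun x => indicator_nonneg (fun x _ => by positivity) x
    refine mul_le_mul_of_nonneg_left (Real.rpow_le_rpow (by positivity) ?_ (by linarith)) hS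
    rw [mul_assoc A, mul_assoc A]
    exact mul_le_mul_of_nonneg_left hind hA

/-! ### Application to the fractional kernel -/

lemma fracKernel_nonneg {N : ℕ} (s p : ℝ) (x : EuclideanSpace ℝ (Fin N)) :
    0 ≤ fracKernel N s p x := Real.rpow_nonneg (norm_nonneg _) _

lemma measurable_fracKernel (N : ℕ) (s p : ℝ) : Measurable (fracKernel N s p) :=
  measurable_norm.pow_const _

end KirchhoffSingular

end

theorem mainTheorem4 (N : ℕ) (hN : 2 ≤ N) (s p γ a b lam mu : ℝ)
    (hs0 : 0 < s) (hs1 : s < 1) (hp : 1 < p) (hsp : s * p < N)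
    (hγ0 : 0 < γ) (hγ1 : γ < 1) (ha : 0 < a) (hb : 0 ≤ b) (hlam : 0 < lam) (hmu : 0 < mu)
    (Ω : Set (EuclideanSpace ℝ (Fin N))) (hΩo : IsOpen Ω) (hΩc : IsConnected Ω)
    (hΩb : Bornology.IsBounded Ω)
    (g h : EuclideanSpace ℝ (Fin N) → ℝ)
    (hgm : AEMeasurable g (volume.restrict Ω)) (hhm : AEMeasurable h (volume.restrict Ω))
    (hg0 : ∀ x ∈ Ω, 0 ≤ g x) (hh0 : ∀ x ∈ Ω, 0 ≤ h x)
    (hgb : ∃ M : ℝ, ∀ x ∈ Ω, g x ≤ M) (hhb : ∃ M : ℝ, ∀ x ∈ Ω, h x ≤ M)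
    (f : EuclideanSpace ℝ (Fin N) → ℝ → ℝ)
    (hf : KirchhoffSingular.IsCaratheodory Ω f) (hf1 : KirchhoffSingular.GrowthF1 Ω s p f)
    (u : EuclideanSpace ℝ (Fin N) → ℝ)
    (hu : KirchhoffSingular.IsWeakSolution Ω (KirchhoffSingular.fracKernel N s p)
      p γ a b lam mu g h f u) :
    MemLp u ⊤ (volume.restrict Ω) := by
  open KirchhoffSingular in
  obtain ⟨C, hC, q, hpq, hqc, hfC⟩ := hf1
  -- The strict gap below p_s^* allows the subcritical inequality at r, while r > q > p makes the
  -- iteration exponent r/p exceed 1.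
  obtain ⟨r, hqr, hrc⟩ := exists_between hqc
  have hp0 : 0 < p := by linarith
  have hr : 0 < r := by linarith
  have hK := fracKernel_nonneg (N := N) s p
  have hKm := measurable_fracKernel N s p
  have hΩ : volume Ω ≠ ⊤ := hΩb.measure_lt_top.ne
  have : IsFiniteMeasure (volume.restrict Ω) := ⟨by simpa using hΩ.lt_top⟩
  obtain ⟨S, hS, hSob⟩ := exists_lintegral_rpow_le (by omega) hs0 hp0 hsp hr hrc hΩ
  have hSob' : ∀ v, MemX0 Ω (fracKernel N s p) p v →
      ∫⁻ x in Ω, ENNReal.ofReal (|v x| ^ r) ≤ ENNReal.ofReal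
        (S * (∫ z in Q Ω, energyDensity (fracKernel N s p) p v z) ^ (r / p)) := fun v hv =>
    hSob v hv.aemeasurable hv.ae_eq_zero _ (integral_nonneg fun z => energyDensity_nonneg hK z)
      (ofReal_integral_eq_lintegral_ofReal hv.integrableOn
        (ae_of_all _ fun z => energyDensity_nonneg hK z)).ge
  have hmeas : ∀ e : ℝ, ∀ v, MemX0 Ω (fracKernel N s p) p v →
      AEStronglyMeasurable (fun x => |v x| ^ e) (volume.restrict Ω) := fun e v hv =>
    ((continuous_abs.measurable.comp_aemeasurable hv.aemeasurable).pow_const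
      e).restrict.aestronglyMeasurable
  have hint : ∀ v, MemX0 Ω (fracKernel N s p) p v → IntegrableOn (fun x => |v x| ^ r) Ω := by
    refine fun v hv => ⟨hmeas r v hv, ?_⟩
    rw [hasFiniteIntegral_iff_ofReal (ae_of_all _ fun x => by positivity)]
    exact (hSob' v hv).trans_lt ENNReal.ofReal_lt_top
  have huq : IntegrableOn (fun x => |u x| ^ q) Ω := by
    refine ((integrable_const (1 : ℝ)).add (hint u hu.memX0)).mono' (hmeas q u hu.memX0)
      (ae_of_all _ fun x => ?_)
    rw [Real.norm_of_nonneg (by positivity)]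
    change |u x| ^ q ≤ 1 + |u x| ^ r
    rcases le_total |u x| 1 with h1 | h1
    · exact (Real.rpow_le_one (abs_nonneg _) h1 (by linarith)).trans
        (le_add_of_nonneg_right (by positivity))
    · exact (Real.rpow_le_rpow_of_exponent_le h1 hqr.le).trans
        (le_add_of_nonneg_left zero_le_one)
  obtain ⟨A, hA, hcac⟩ := hu.exists_integral_energyDensity_excess_le hK hKm hp hγ0.le ha hb
    hlam.le hmu.le hΩo.measurableSet hg0 hh0 hgb hhb hC.le hpq.le hfC huq
  have hiter : ∀ k : ℝ, 1 ≤ k → ∫ x in Ω, |excess k (u x)| ^ r ≤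
      S * (A * ∫ x in Ω, {x | k < |u x|}.indicator (fun x => |u x| ^ q) x) ^ (r / p) := by
    intro k hk
    have hX := hu.memX0.excess hK hKm hp0.le (by linarith : 0 ≤ k)
    have hE : 0 ≤ ∫ z in Q Ω, energyDensity (fracKernel N s p) p (fun x => excess k (u x)) z :=
      integral_nonneg fun z => energyDensity_nonneg hK z
    have h1 := hSob' _ hX
    rw [← ofReal_integral_eq_lintegral_ofReal (hint _ hX) (ae_of_all _ fun x => by positivity),
      ENNReal.ofReal_le_ofReal_iff (by positivity)] at h1
    exact h1.trans (mul_le_mul_of_nonneg_left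
      (Real.rpow_le_rpow hE (hcac k hk) (by positivity)) hS)
  obtain ⟨M, hM⟩ := exists_ae_abs_le_of_excess hu.memX0.aemeasurable.restrict
    hqr.le hr ((one_lt_div hp0).2 (hpq.trans hqr)) hA hS (hint u hu.memX0) hiter
  exact memLp_top_of_bound hu.memX0.aemeasurable.restrict.aestronglyMeasurable M hM
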